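/- Let $\mathcal P(n)$ be the manifold of real symmetric positive definite $n\times n$ matrices with tangent spaces $T_Y\mathcal P(n)\equiv\mathcal S(n)$ (the symmetric matrices), the affine-invariant metric $\langle U,V\rangle_Y=\operatorname{tr}(Y^{-1}UY^{-1}V)$, its norm $\|V\|_Y=\langle V,V\rangle_Y^{1/2}$, the distance $d(X,Y)=\operatorname{tr}^{1/2}\big(\operatorname{Log}^2(Y^{-1/2}XY^{-1/2})\big)$ and the exponential map $\exp_Y(V)=Y^{1/2}\operatorname{Exp}(Y^{-1/2}VY^{-1/2})Y^{1/2}$, where $\operatorname{Exp}$ and $\operatorname{Log}$ are the matrix exponential and logarithm. Let $X,Y\in\mathcal P(n)$ and $V\in\mathcal S(n)\setminus\{0\}$, and let $$Y^{-1/2}VY^{-1/2}=UDU^T,\qquad D=\operatorname{diag}(\lambda_1I_{n_1},\dots,\lambda_kI_{n_k}),$$ be a spectral decomposition, where $U$ is orthogonal, $\lambda_1<\dots<\lambda_k$ are the distinct eigenvalues of $Y^{-1/2}VY^{-1/2}$ in increasing order, and $n_i\ge 1$ is the multiplicity of $\lambda_i$ (so $n_1+\dots+n_k=n$). Let $$U^TY^{-1/2}XY^{-1/2}U=LL^T$$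 be the Cholesky decomposition ($L$ lower triangular with positive diagonal entries $L_{jj}$). Put $\alpha_0=0$ and $\alpha_i=n_1+\dots+n_i$. Then the limit that defines the Busemann function, $$B_{Y,V}(X)=\lim_{t\to+\infty}\big(d(X,\exp_Y(tV))-\|V\|_Y\,t\big),$$ exists and $$B_{Y,V}(X)=-2\Big(\sum_{i=1}^kn_i\lambda_i^2\Big)^{-1/2}\sum_{i=1}^k\ \sum_{j=\alpha_{i-1}+1}^{\alpha_i}\lambda_i\ln(L_{jj}).$$ Moreover, $B_{Y,V}:\mathcal P(n)\to\mathbb R$ is differentiable at $X$ and its Riemannian gradient there (the matrix $G\in\mathcal S(n)$ with $dB_{Y,V}(X)[H]=\langle G,H\rangle_X$ for all $H\in\mathcal S(n)$) is $$\operatorname{grad}B_{Y,V}(X)=-\Big(\sum_{i=1}^kn_i\lambda_i^2\Big)^{-1/2}\,Y^{1/2}ULDL^TU^TY^{1/2}.$$ -/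

import Mathlib

open Filter Topology

noncomputable section

namespace SPDBusemann

/-- The set `P(n)` of symmetric positive definite real `n × n` matrices. -/
def SPD (n : ℕ) : Set (Matrix (Fin n) (Fin n) ℝ) := {X | X.PosDef}

variable {n : ℕ}

/-- The positive square root `Y^{1/2}` of a symmetric positive definite matrix
(functional calculus: the square root is applied to the eigenvalues). -/
def msqrt (Y : Matrix (Fin n) (Fin n) ℝ) : Matrix (Fin n) (Fin n) ℝ := cfc Real.sqrt Y

/-- The matrix `Y^{-1/2}`, the inverse of `Y^{1/2}`. -/
def minvsqrt (Y : Matrix (Fin n) (Fin n) ℝ) : Matrix (Fin n) (Fin n) ℝ := (msqrt Y)⁻¹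

/-- The matrix logarithm `Log` of a symmetric positive definite matrix
(functional calculus: the logarithm is applied to the eigenvalues). -/
def mlog (X : Matrix (Fin n) (Fin n) ℝ) : Matrix (Fin n) (Fin n) ℝ := cfc Real.log X

/-- The affine-invariant Riemannian metric `⟨U, V⟩_Y = tr (Y⁻¹ U Y⁻¹ V)` at `Y`, on the tangent
space at `Y`, which is the space of symmetric matrices. -/
def metric (Y U V : Matrix (Fin n) (Fin n) ℝ) : ℝ := (Y⁻¹ * U * Y⁻¹ * V).trace

/-- The norm `‖V‖_Y` of a tangent vector `V` at `Y`. -/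
def tnorm (Y V : Matrix (Fin n) (Fin n) ℝ) : ℝ := Real.sqrt (metric Y V V)

/-- The affine-invariant Riemannian distance `d(X, Y) = tr^{1/2} (Log² (Y^{-1/2} X Y^{-1/2}))`. -/
def spdDist (X Y : Matrix (Fin n) (Fin n) ℝ) : ℝ :=
  Real.sqrt ((mlog (minvsqrt Y * X * minvsqrt Y) ^ 2).trace)

/-- The exponential map `exp_Y(V) = Y^{1/2} Exp(Y^{-1/2} V Y^{-1/2}) Y^{1/2}` of the
affine-invariant metric. -/
def spdExp (Y V : Matrix (Fin n) (Fin n) ℝ) : Matrix (Fin n) (Fin n) ℝ :=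
  msqrt Y * NormedSpace.exp (minvsqrt Y * V * minvsqrt Y) * msqrt Y

/-- The function `t ↦ d(X, exp_Y(tV)) - ‖V‖_Y t`. -/
def busemannAux (Y V X : Matrix (Fin n) (Fin n) ℝ) (t : ℝ) : ℝ :=
  spdDist X (spdExp Y (t • V)) - tnorm Y V * t

/-- The Busemann function `B_{Y,V}(X) = lim_{t → +∞} (d(X, exp_Y(tV)) - ‖V‖_Y t)`. -/
def busemann (Y V X : Matrix (Fin n) (Fin n) ℝ) : ℝ := limUnder atTop (busemannAux Y V X)

/-- `f`, regarded as a function on `P(n)`, is differentiable at `X ∈ P(n)` and its Riemannian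
gradient there is the tangent vector `G`: `df(X)[H] = ⟨G, H⟩_X` for all tangent vectors `H`.
Only the values of `f` on `P(n)` matter. -/
def HasRiemGrad (f : Matrix (Fin n) (Fin n) ℝ → ℝ) (X G : Matrix (Fin n) (Fin n) ℝ) : Prop :=
  G.IsSymm ∧ ∃ f' : Matrix (Fin n) (Fin n) ℝ →L[ℝ] ℝ,
    HasFDerivWithinAt f f' (SPD n) X ∧ ∀ H, H.IsSymm → f' H = metric X G H

/-- The partial sums `α_i = n_1 + ⋯ + n_i` of the block sizes (`m` is indexed from `0`, so that
`partialSum m i` is the sum of the first `i` sizes). -/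
def partialSum {k : ℕ} (m : Fin k → ℕ) (i : ℕ) : ℕ := ∑ l : Fin k with l.val < i, m l

/-- The (zero-based) indices in the `i`-th diagonal block: `α_i ≤ j < α_{i+1}`. -/
def block {k : ℕ} (n : ℕ) (m : Fin k → ℕ) (i : Fin k) : Finset (Fin n) :=
  Finset.univ.filter fun j => partialSum m i.val ≤ j.val ∧ j.val < partialSum m (i.val + 1)

/-- The block diagonal matrix with consecutive diagonal blocks `lam i • I` of size `m i`. -/
def blockDiag {k : ℕ} (n : ℕ) (m : Fin k → ℕ) (lam : Fin k → ℝ) : Matrix (Fin n) (Fin n) ℝ :=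
  Matrix.diagonal fun j => ∑ i : Fin k, if j ∈ block n m i then lam i else 0

/-- `A = U D Uᵀ` is a spectral decomposition of `A`, where `U` is orthogonal and `D` is block
diagonal with blocks `lam i • I` of sizes `m i ≥ 1` adding up to `n`, `lam 0 < lam 1 < ⋯`. Hence
the `lam i` are the distinct eigenvalues of `A` and the `m i` are their multiplicities. -/
structure IsSpectralDecomp {k : ℕ} (A U : Matrix (Fin n) (Fin n) ℝ)
    (m : Fin k → ℕ) (lam : Fin k → ℝ) : Prop where
  orthogonal : U ∈ Matrix.orthogonalGroup (Fin n) ℝ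
  strictMono : StrictMono lam
  pos : ∀ i, 0 < m i
  sum_eq : ∑ i, m i = n
  eq : A = U * blockDiag n m lam * U.transpose

/-- `A = L Lᵀ` is the Cholesky decomposition of `A`: `L` is lower triangular with positive
diagonal. -/
structure IsCholesky (A L : Matrix (Fin n) (Fin n) ℝ) : Prop where
  lower : ∀ i j, i < j → L i j = 0
  diag_pos : ∀ i, 0 < L i i
  eq : A = L * L.transpose

end SPDBusemann

end

/-! Put `P = Y^{1/2} U`. Then `X = P (L Lᵀ) Pᵀ` and the ray is `P e^{tD} Pᵀ`. The distance depends
only on the spectrum of `X W⁻¹`, so it equals the Frobenius norm of `Log (Lᵀ e^{-tD} L)`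
(`spdDist_conj_expDiag`). As `D` increases along the diagonal and `L` is lower triangular,
`e^{-tD/2} L e^{tD/2}` tends to the block diagonal part `N` of `L`. Hence `Lᵀ e^{-tD} L = Fᵀ K F`
with `F = N e^{-tD/2}` and `K → 1`, and operator monotonicity of the logarithm allows `K` to be
dropped although `F` degenerates (`tendsto_log_conjugate_sub_log`). Since `N` commutes with `D`,
what remains is the norm of `Log (Nᵀ N) - t D`, the square root of a quadratic in `t` whose linear
term is found from determinants of blocks (`trace_diagonal_mul_mlog`).

For the gradient, `2 ln L_jj` is the logarithm of a quotient of consecutive leading minors of `L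
Lᵀ`, so the Busemann function is `minorSum` up to a constant factor and a congruence. A lower
triangular congruence changes `minorSum` by a constant (`minorSum_conj`), so differentiation is
needed only at the identity, where the derivative is `H ↦ tr (D H)`. -/

namespace SPDBusemann

/-! ### Perturbation of the operator logarithm under congruence -/

section CStar

variable {A : Type*} [CStarAlgebra A] [PartialOrder A] [StarOrderedRing A]

theorem norm_le_of_neg_algebraMap_le_of_le_algebraMap {x : A} {r : ℝ} (hr : 0 ≤ r)
    (hx : IsSelfAdjoint x) (h₁ : -algebraMap ℝ A r ≤ x) (h₂ : x ≤ algebraMap ℝ A r) :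
    ‖x‖ ≤ r := by
  obtain _ | _ := subsingleton_or_nontrivial A
  · simpa [Subsingleton.elim x 0] using hr
  rw [le_algebraMap_iff_spectrum_le] at h₂
  rw [← map_neg, algebraMap_le_iff_le_spectrum] at h₁
  rcases CStarAlgebra.norm_or_neg_norm_mem_spectrum hx with h | h
  · exact h₂ _ h
  · linarith [h₁ _ h]

/-- The logarithm is operator monotone and turns the factor `c` into the additive scalar `Real.log
c`. -/
theorem norm_log_sub_log_le {a b : A} {c : ℝ} (hc : 1 ≤ c) (ha : IsStrictlyPositive a)
    (hb : IsStrictlyPositive b) (hab : a ≤ c • b) (hba : b ≤ c • a) :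
    ‖CFC.log a - CFC.log b‖ ≤ Real.log c := by
  have hc0 : 0 < c := by linarith
  have h1 := CFC.log_le_log hab ha
  have h2 := CFC.log_le_log hba hb
  rw [CFC.log_smul' _ hc0] at h1 h2
  refine norm_le_of_neg_algebraMap_le_of_le_algebraMap (Real.log_nonneg hc)
    (IsSelfAdjoint.log.sub IsSelfAdjoint.log) ?_ ?_
  · rwa [neg_le_sub_iff_le_add, add_comm]
  · rwa [sub_le_iff_le_add]

/-- Congruence by `F t` preserves order comparisons between `K t` and `1`, so the resulting bound
does not involve `F t`, which may degenerate along `l`. -/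
theorem tendsto_log_conjugate_sub_log {ι : Type*} {l : Filter ι} {K F : ι → A}
    (hK : Tendsto K l (𝓝 1)) (hKs : ∀ t, IsSelfAdjoint (K t)) (hF : ∀ t, IsUnit (F t)) :
    Tendsto (fun t => CFC.log (star (F t) * K t * F t) - CFC.log (star (F t) * F t)) l (𝓝 0) := by
  have hlog : Tendsto (fun t => Real.log (1 + 2 * ‖K t - 1‖)) l (𝓝 0) := by
    have h : Tendsto (fun t => 1 + 2 * ‖K t - 1‖) l (𝓝 1) := by
      have := (tendsto_iff_norm_sub_tendsto_zero.1 hK).const_mul 2 |>.const_add 1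
      simpa using this
    simpa using h.log one_ne_zero
  refine squeeze_zero_norm' ?_ hlog
  -- For `e ≤ 1/2` one has `(1 + 2e)(1 - e) = 1 + e(1 - 2e) ≥ 1`, so the single constant `1 + 2e`
  -- serves in both comparisons.
  have hev : ∀ᶠ t in l, ‖K t - 1‖ < 1 / 2 :=
    (tendsto_iff_norm_sub_tendsto_zero.1 hK).eventually_lt_const (by norm_num)
  filter_upwards [hev] with t ht
  set e := ‖K t - 1‖ with he
  have he0 : 0 ≤ e := norm_nonneg _
  have hs : IsSelfAdjoint (K t - 1) := (hKs t).sub (IsSelfAdjoint.one A)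
  have h1 : K t ≤ (1 + 2 * e) • (1 : A) := by
    have := hs.le_algebraMap_norm_self
    rw [sub_le_iff_le_add, ← he] at this
    refine this.trans ?_
    rw [Algebra.algebraMap_eq_smul_one, ← sub_nonneg,
      show (1 + 2 * e) • (1 : A) - (e • (1 : A) + 1) = e • (1 : A) by module]
    exact smul_nonneg he0 zero_le_one
  have h2 : (1 - e) • (1 : A) ≤ K t := by
    have := hs.neg_algebraMap_norm_le_self
    rw [neg_le_sub_iff_le_add, ← he, Algebra.algebraMap_eq_smul_one] at this
    rw [sub_smul, one_smul, sub_le_iff_le_add]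
    exact this
  have h3 : (1 : A) ≤ (1 + 2 * e) • K t := by
    have := smul_le_smul_of_nonneg_left h2 (by positivity : 0 ≤ 1 + 2 * e)
    refine le_trans ?_ this
    rw [smul_smul, ← sub_nonneg, show ((1 + 2 * e) * (1 - e)) • (1 : A) - 1
      = (e * (1 - 2 * e)) • (1 : A) by module]
    exact smul_nonneg (mul_nonneg he0 (by linarith)) zero_le_one
  have hKp : IsStrictlyPositive (K t) :=
    ((isStrictlyPositive_one (A := A)).smul (by linarith : 0 < 1 - e)).of_le h2
  refine norm_log_sub_log_le (by linarith)
    ((hF t).isStrictlyPositive_star_left_conjugate_iff.2 hKp) ?_ ?_ ?_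
  · simpa using (hF t).isStrictlyPositive_star_left_conjugate_iff.2
      (isStrictlyPositive_one (A := A))
  · simpa using star_left_conjugate_le_conjugate h1 (F t)
  · simpa using star_left_conjugate_le_conjugate h3 (F t)

end CStar

/-! ### Transfer of the estimate to real matrices -/

section Complexification

open scoped Matrix.Norms.L2Operator MatrixOrder ComplexOrder

variable {n : ℕ}

/-- Extension of scalars from real to complex matrices, as a star algebra homomorphism. -/
def complexify (n : ℕ) : Matrix (Fin n) (Fin n) ℝ →⋆ₐ[ℝ] Matrix (Fin n) (Fin n) ℂ :=
  { (Complex.ofRealAm.mapMatrix : Matrix (Fin n) (Fin n) ℝ →ₐ[ℝ] Matrix (Fin n) (Fin n) ℂ) with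
    map_star' := fun M => by
      ext i j
      simp [Matrix.star_eq_conjTranspose] }

theorem continuous_complexify : Continuous (complexify n) := by
  refine continuous_pi fun i => continuous_pi fun j => ?_
  exact Complex.continuous_ofReal.comp (continuous_id.matrix_elem i j)

/-- Star homomorphisms commute with the functional calculus; the spectrum is finite, so continuity
of `Real.log` on it needs no positivity. -/
theorem complexify_mlog {M : Matrix (Fin n) (Fin n) ℝ} (hM : M.IsHermitian) :
    complexify n (mlog M) = CFC.log (complexify n M) := by
  refine StarAlgHomClass.map_cfc (R := ℝ) (S := ℝ) (complexify n) Real.log M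
    (M.finite_real_spectrum.continuousOn _) continuous_complexify hM ?_
  exact IsSelfAdjoint.map hM (complexify n)

theorem tendsto_mlog_conjugate_sub_mlog {ι : Type*} {l : Filter ι}
    {K F : ι → Matrix (Fin n) (Fin n) ℝ} (hK : Tendsto K l (𝓝 1))
    (hKs : ∀ t, (K t).IsHermitian) (hF : ∀ t, IsUnit (F t)) :
    Tendsto (fun t => mlog ((F t).transpose * K t * F t) - mlog ((F t).transpose * F t)) l
      (𝓝 0) := by
  have hK' : Tendsto (fun t => complexify n (K t)) l (𝓝 1) := by
    simpa [Function.comp_def] using (continuous_complexify.tendsto 1).comp hK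
  have key := tendsto_log_conjugate_sub_log (F := fun t => complexify n (F t)) hK'
    (fun t => IsSelfAdjoint.map (hKs t) (complexify n)) (fun t => (hF t).map (complexify n))
  have hh : ∀ t, star (F t) = (F t).transpose := fun t => by
    rw [Matrix.star_eq_conjTranspose, Matrix.conjTranspose_eq_transpose_of_trivial]
  have key2 : Tendsto (fun t => complexify n
      (mlog ((F t).transpose * K t * F t) - mlog ((F t).transpose * F t))) l (𝓝 0) := by
    refine key.congr fun t => ?_
    rw [map_sub, complexify_mlog, complexify_mlog, ← hh]
    · simp [map_mul, map_star]
    · simpa using Matrix.isHermitian_conjTranspose_mul_self (F t)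
    · simpa using Matrix.isHermitian_conjTranspose_mul_mul (F t) (hKs t)
  refine tendsto_pi_nhds.2 fun i => tendsto_pi_nhds.2 fun j => ?_
  have h := ((Complex.continuous_re.comp (continuous_id.matrix_elem i j)).tendsto 0).comp key2
  exact h

end Complexification

end SPDBusemann

/-! ### Traces of logarithms and commuting idempotents -/

namespace SPDBusemann

variable {n : ℕ}

theorem trace_cfc_eq_sum {A : Matrix (Fin n) (Fin n) ℝ} (hA : A.IsHermitian) (f : ℝ → ℝ) :
    (cfc f A).trace = ∑ i, f (hA.eigenvalues i) := by
  rw [hA.cfc_eq, Matrix.IsHermitian.cfc, Unitary.conjStarAlgAut_apply, Matrix.trace_mul_comm,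
    ← mul_assoc]
  simp [Matrix.trace]

theorem isHermitian_mlog (A : Matrix (Fin n) (Fin n) ℝ) : (mlog A).IsHermitian :=
  cfc_predicate Real.log A

theorem trace_mlog_sq {A : Matrix (Fin n) (Fin n) ℝ} (hA : A.IsHermitian) :
    (mlog A ^ 2).trace = ∑ i, Real.log (hA.eigenvalues i) ^ 2 := by
  have hA' : IsSelfAdjoint A := hA
  rw [mlog, ← cfc_pow Real.log 2 A (A.finite_real_spectrum.continuousOn _), trace_cfc_eq_sum hA]

theorem trace_mlog_sq_eq_of_charpoly_eq {A B : Matrix (Fin n) (Fin n) ℝ} (hA : A.IsHermitian)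
    (hB : B.IsHermitian) (h : A.charpoly = B.charpoly) :
    (mlog A ^ 2).trace = (mlog B ^ 2).trace := by
  rw [trace_mlog_sq hA, trace_mlog_sq hB, (hA.eigenvalues_eq_eigenvalues_iff hB).2 h]

theorem trace_mlog {A : Matrix (Fin n) (Fin n) ℝ} (hA : A.PosDef) :
    (mlog A).trace = Real.log A.det := by
  rw [mlog, trace_cfc_eq_sum hA.isHermitian, hA.isHermitian.det_eq_prod_eigenvalues]
  simp only [RCLike.ofReal_real_eq_id, id_eq]
  rw [Real.log_prod fun i _ => (hA.eigenvalues_pos i).ne']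

section
open scoped Matrix.Norms.L2Operator MatrixOrder

theorem mlog_exp {A : Matrix (Fin n) (Fin n) ℝ} (hA : A.IsHermitian) :
    mlog (NormedSpace.exp A) = A :=
  CFC.log_exp A hA

theorem exp_mlog {A : Matrix (Fin n) (Fin n) ℝ} (hA : A.PosDef) :
    NormedSpace.exp (mlog A) = A :=
  CFC.exp_log A (Matrix.isStrictlyPositive_iff_posDef.2 hA)

/-- `(E C)^k = E C^k` for `k ≥ 1`; the term `k = 0` is `1 = E + (1 - E)`, whence the correction. -/
theorem exp_mul_of_idempotent {E C : Matrix (Fin n) (Fin n) ℝ} (hE : E * E = E)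
    (hEC : Commute E C) : NormedSpace.exp (E * C) = E * NormedSpace.exp C + (1 - E) := by
  have h1 := (NormedSpace.exp_series_hasSum_exp' (𝕂 := ℝ) C).mul_left E
  have h2 := NormedSpace.exp_series_hasSum_exp' (𝕂 := ℝ) (E * C)
  have h3 : HasSum (fun k : ℕ => if k = 0 then 1 - E else 0) (1 - E) := hasSum_ite_eq 0 (1 - E)
  refine h2.unique ((h1.add h3).congr_fun fun k => ?_)
  rw [hEC.mul_pow]
  rcases k with _ | k
  · simp
  · simp [IsIdempotentElem.pow_succ_eq k hE]

end

theorem commute_mlog {A B : Matrix (Fin n) (Fin n) ℝ} (h : Commute B A) :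
    Commute B (mlog A) := 
  (h.symm.cfc_real _).symm

theorem mlog_idempotent_mul_add {E Q : Matrix (Fin n) (Fin n) ℝ} (hE : E * E = E)
    (hEs : E.IsHermitian) (hQ : Q.PosDef) (hEQ : Commute E Q) :
    mlog (E * Q + (1 - E)) = E * mlog Q := by
  have hc := commute_mlog hEQ
  have h := exp_mul_of_idempotent hE hc
  rw [exp_mlog hQ] at h
  rw [← h, mlog_exp]
  rw [Matrix.IsHermitian, Matrix.conjTranspose_mul, hEs, isHermitian_mlog, hc.eq]

end SPDBusemann

/-! ### Block determinants of triangular matrices -/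

namespace SPDBusemann

variable {n : ℕ}

theorem det_eq_prod_of_lower {L : Matrix (Fin n) (Fin n) ℝ} (hL : ∀ i j, i < j → L i j = 0) :
    L.det = ∏ i, L i i :=
  Matrix.det_of_isLowerTriangular L fun i j h => hL i j h

/-- The coordinate projection onto the indices in `s`. -/
def coordProj (s : Finset (Fin n)) : Matrix (Fin n) (Fin n) ℝ :=
  Matrix.diagonal fun j => if j ∈ s then 1 else 0

theorem coordProj_mul_self (s : Finset (Fin n)) : coordProj s * coordProj s = coordProj s := by
  simp [coordProj, Matrix.diagonal_mul_diagonal]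

theorem transpose_coordProj (s : Finset (Fin n)) : (coordProj s).transpose = coordProj s := by
  simp [coordProj]

theorem det_compression_of_lower {L : Matrix (Fin n) (Fin n) ℝ} (hL : ∀ i j, i < j → L i j = 0)
    (s : Finset (Fin n)) :
    (coordProj s * L * coordProj s + (1 - coordProj s)).det = ∏ j ∈ s, L j j := by
  rw [det_eq_prod_of_lower]
  · simp only [coordProj, Matrix.add_apply, Matrix.mul_diagonal, Matrix.diagonal_mul,
      Matrix.sub_apply, Matrix.one_apply_eq, Matrix.diagonal_apply_eq]
    rw [← Finset.prod_subset (Finset.subset_univ s)]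
    · exact Finset.prod_congr rfl fun j hj => by simp [hj]
    · intro j _ hj
      simp [hj]
  · intro i j hij
    simp [coordProj, hL i j hij, Matrix.mul_diagonal, hij.ne]

theorem posDef_transpose_mul_self {M : Matrix (Fin n) (Fin n) ℝ} (hM : M.det ≠ 0) :
    (M.transpose * M).PosDef := by
  rw [← Matrix.conjTranspose_eq_transpose_of_trivial]
  exact Matrix.PosDef.conjTranspose_mul_self M
    (Matrix.mulVec_injective_of_isUnit ((Matrix.isUnit_iff_isUnit_det M).2 hM.isUnit))

/-- With `E` the projection and `M = E N E + (1 - E)`, the product `E * mlog (Nᵀ N)` is `mlog (Mᵀ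
M)`, and its trace is `log (det M)²`, with `M` triangular. -/
theorem trace_coordProj_mul_mlog {N : Matrix (Fin n) (Fin n) ℝ} (hN : ∀ i j, i < j → N i j = 0)
    (hN0 : ∀ i, 0 < N i i) (s : Finset (Fin n)) (hs : Commute (coordProj s) N) :
    (coordProj s * mlog (N.transpose * N)).trace = 2 * ∑ j ∈ s, Real.log (N j j) := by
  have hE := coordProj_mul_self s
  have hEt := transpose_coordProj s
  have hdet := det_compression_of_lower hN s
  have hc : coordProj s * N = N * coordProj s := hs
  have hct : coordProj s * N.transpose = N.transpose * coordProj s := by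
    simpa [hEt] using (congrArg Matrix.transpose hc).symm
  set E := coordProj s
  set M := E * N * E + (1 - E) with hM
  have hNd : N.det ≠ 0 := by
    rw [det_eq_prod_of_lower hN]
    exact (Finset.prod_pos fun i _ => hN0 i).ne'
  have hpos : 0 < ∏ j ∈ s, N j j := Finset.prod_pos fun i _ => hN0 i
  have hMM : E * (N.transpose * N) + (1 - E) = M.transpose * M := by
    have h1 : M = E * N + (1 - E) := by rw [hM, hc, mul_assoc, hE]
    have h2 : M.transpose = N.transpose * E + (1 - E) := by
      rw [h1]; simp [hEt]
    have h3 : E * (1 - E) = 0 := by rw [mul_sub, hE, mul_one, sub_self]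
    have h4 : (1 - E) * E = 0 := by rw [sub_mul, hE, one_mul, sub_self]
    have h5 : (1 - E) * (1 - E) = 1 - E := by rw [mul_sub, h4, mul_one, sub_zero]
    rw [h2, h1, add_mul, mul_add, mul_add, h5, mul_assoc _ E (1 - E), h3, ← mul_assoc (1 - E), h4,
      mul_zero, zero_mul, zero_add, add_zero, mul_assoc, ← mul_assoc E E, hE, ← mul_assoc,
      ← mul_assoc, hct]
  rw [← mlog_idempotent_mul_add hE, hMM, trace_mlog, Matrix.det_mul, Matrix.det_transpose, hdet,
    Real.log_mul hpos.ne' hpos.ne', Real.log_prod fun i _ => (hN0 i).ne', two_mul]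
  · exact posDef_transpose_mul_self (hdet ▸ hpos.ne')
  · rw [Matrix.IsHermitian, Matrix.conjTranspose_eq_transpose_of_trivial, hEt]
  · exact posDef_transpose_mul_self hNd
  · exact (show Commute E N.transpose from hct).mul_right hs

/-- The individual diagonal entries of the logarithm are not `2 log N_jj`; only their sums over the
level sets of `d` agree, and this suffices because `d` is constant there. -/
theorem trace_diagonal_mul_mlog {N : Matrix (Fin n) (Fin n) ℝ} {d : Fin n → ℝ}
    (hN : ∀ i j, i < j → N i j = 0) (hN0 : ∀ i, 0 < N i i) (hd : ∀ i j, d i ≠ d j → N i j = 0) :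
    (Matrix.diagonal d * mlog (N.transpose * N)).trace = 2 * ∑ j, d j * Real.log (N j j) := by
  set C := mlog (N.transpose * N) with hC
  have h1 : ∀ v, ∑ j with d j = v, C j j = 2 * ∑ j with d j = v, Real.log (N j j) := by
    intro v
    rw [← trace_coordProj_mul_mlog hN hN0, ← hC, coordProj, Matrix.trace]
    · simp [Matrix.diagonal_mul, Finset.sum_filter]
    · ext i j
      simp only [coordProj, Matrix.diagonal_mul, Matrix.mul_diagonal]
      by_cases h : d i = d j
      · simp [h, mul_comm]
      · simp [hd i j h]
  have h2 : ∀ f : Fin n → ℝ, ∑ j, d j * f j =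
      ∑ v ∈ Finset.univ.image d, v * ∑ j with d j = v, f j := by
    intro f
    rw [← Finset.sum_fiberwise_of_maps_to (g := d) (t := Finset.univ.image d) (by simp)]
    refine Finset.sum_congr rfl fun v _ => ?_
    rw [Finset.mul_sum]
    exact Finset.sum_congr rfl fun j hj => by rw [(Finset.mem_filter.1 hj).2]
  simp only [Matrix.trace, Matrix.diag_apply, Matrix.diagonal_mul]
  rw [h2, h2, Finset.mul_sum]
  exact Finset.sum_congr rfl fun v _ => by rw [h1]; ring

end SPDBusemann

/-! ### Asymptotics of the distance along the ray -/

namespace SPDBusemann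

variable {n : ℕ}

section
open scoped Matrix.Norms.Frobenius

theorem sqrt_trace_sq_eq_norm {M : Matrix (Fin n) (Fin n) ℝ} (hM : M.IsHermitian) :
    Real.sqrt (M ^ 2).trace = ‖M‖ := by
  rw [Matrix.frobenius_norm_def, Real.sqrt_eq_rpow, pow_two]
  congr 1
  simp only [Matrix.trace, Matrix.diag_apply, Matrix.mul_apply, Real.norm_eq_abs, Real.rpow_two,
    sq_abs]
  refine Finset.sum_congr rfl fun i _ => Finset.sum_congr rfl fun j _ => ?_
  have : M j i = M i j := by simpa using hM.apply i j
  rw [this, pow_two]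

theorem tendsto_sqrt_trace_sq_sub {ι : Type*} {l : Filter ι}
    {A B : ι → Matrix (Fin n) (Fin n) ℝ} (hA : ∀ t, (A t).IsHermitian)
    (hB : ∀ t, (B t).IsHermitian) (h : Tendsto (fun t => A t - B t) l (𝓝 0)) :
    Tendsto (fun t => Real.sqrt (A t ^ 2).trace - Real.sqrt (B t ^ 2).trace) l (𝓝 0) := by
  have h' : Tendsto (fun t => ‖A t - B t‖) l (𝓝 0) := by
    simpa [Function.comp_def] using (continuous_norm.tendsto (0 : Matrix (Fin n) (Fin n) ℝ)).comp h
  refine squeeze_zero_norm (fun t => ?_) h'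
  rw [sqrt_trace_sq_eq_norm (hA t), sqrt_trace_sq_eq_norm (hB t)]
  exact abs_norm_sub_norm_le _ _

end

/-- Multiply and divide by the conjugate sum, then divide numerator and denominator by `t`. -/
theorem tendsto_sqrt_quadratic_sub {a b c : ℝ} (hc : 0 < c)
    (h : ∀ t : ℝ, 0 ≤ a - 2 * b * t + c * t ^ 2) :
    Tendsto (fun t : ℝ => Real.sqrt (a - 2 * b * t + c * t ^ 2) - Real.sqrt c * t) atTop
      (𝓝 (-b / Real.sqrt c)) := by
  have hi : Tendsto (fun t : ℝ => t⁻¹) atTop (𝓝 0) := tendsto_inv_atTop_zero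
  have hs : 0 < Real.sqrt c := Real.sqrt_pos.2 hc
  have h1 : Tendsto (fun t : ℝ => a * t⁻¹ - 2 * b) atTop (𝓝 (-2 * b)) := by
    simpa using (hi.const_mul a).sub_const (2 * b)
  have h2 : Tendsto (fun t : ℝ => Real.sqrt (a * t⁻¹ ^ 2 - 2 * b * t⁻¹ + c) + Real.sqrt c) atTop
      (𝓝 (Real.sqrt c + Real.sqrt c)) := by
    have : Tendsto (fun t : ℝ => a * t⁻¹ ^ 2 - 2 * b * t⁻¹ + c) atTop (𝓝 c) := by
      simpa using (((hi.pow 2).const_mul a).sub (hi.const_mul (2 * b))).add_const c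
    exact this.sqrt.add_const _
  have h3 := h1.div h2 (by positivity)
  rw [show -b / Real.sqrt c = -2 * b / (Real.sqrt c + Real.sqrt c) by field_simp; ring]
  refine h3.congr' ?_
  filter_upwards [eventually_gt_atTop 0] with t ht
  have e1 : a - 2 * b * t + c * t ^ 2 = t ^ 2 * (a * t⁻¹ ^ 2 - 2 * b * t⁻¹ + c) := by
    field_simp
  have hq : 0 ≤ a * t⁻¹ ^ 2 - 2 * b * t⁻¹ + c := by
    have := h t
    rw [e1] at this
    exact nonneg_of_mul_nonneg_right this (by positivity)
  rw [e1, Real.sqrt_mul (by positivity), Real.sqrt_sq ht.le, Pi.div_apply,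
    div_eq_iff (by positivity)]
  have e2 := Real.sq_sqrt hq
  have e3 := Real.sq_sqrt hc.le
  have e4 : (t * Real.sqrt (a * t⁻¹ ^ 2 - 2 * b * t⁻¹ + c) - Real.sqrt c * t) *
      (Real.sqrt (a * t⁻¹ ^ 2 - 2 * b * t⁻¹ + c) + Real.sqrt c) = t *
      (Real.sqrt (a * t⁻¹ ^ 2 - 2 * b * t⁻¹ + c) ^ 2 - Real.sqrt c ^ 2) := by ring
  rw [e4, e2, e3]
  field_simp
  ring

/-- The diagonal matrix `Exp(t D)` for `D = diagonal d`. -/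
noncomputable def expDiag (d : Fin n → ℝ) (t : ℝ) : Matrix (Fin n) (Fin n) ℝ :=
  Matrix.diagonal fun j => Real.exp (t * d j)

theorem expDiag_mul (d : Fin n → ℝ) (s t : ℝ) :
    expDiag d s * expDiag d t = expDiag d (s + t) := by
  simp [expDiag, Matrix.diagonal_mul_diagonal, ← Real.exp_add, add_mul]

theorem expDiag_zero (d : Fin n → ℝ) : expDiag d 0 = 1 := by
  simp [expDiag]

theorem transpose_expDiag (d : Fin n → ℝ) (t : ℝ) : (expDiag d t).transpose = expDiag d t := by
  simp [expDiag]

theorem exp_smul_diagonal (d : Fin n → ℝ) (t : ℝ) :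
    NormedSpace.exp (t • Matrix.diagonal d) = expDiag d t := by
  rw [← Matrix.diagonal_smul, Matrix.exp_diagonal, expDiag]
  congr 1
  ext j
  simp [Real.exp_eq_exp_ℝ]

theorem isUnit_expDiag (d : Fin n → ℝ) (t : ℝ) : IsUnit (expDiag d t) :=
  IsUnit.of_mul_eq_one (expDiag d (-t)) (by rw [expDiag_mul, add_neg_cancel, expDiag_zero])

theorem mlog_conjugate_expDiag {Q : Matrix (Fin n) (Fin n) ℝ} (d : Fin n → ℝ) (hQ : Q.PosDef)
    (hd : Commute (Matrix.diagonal d) Q) (t : ℝ) :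
    mlog (expDiag d (-t / 2) * Q * expDiag d (-t / 2)) = mlog Q - t • Matrix.diagonal d := by
  have hc : Commute (Matrix.diagonal d) (mlog Q) := commute_mlog hd
  -- Entrywise, commuting with `diagonal d` means that `Q i j = 0` or `d i = d j`.
  have h1 : Commute (expDiag d (-t / 2)) Q := by
    ext i j
    have h := congrFun (congrFun hd.eq i) j
    simp only [expDiag, Matrix.diagonal_mul, Matrix.mul_diagonal] at h ⊢
    rw [mul_comm (Q i j)] at h
    rcases eq_or_ne (Q i j) 0 with h0 | h0
    · simp [h0]
    · rw [mul_right_cancel₀ h0 h, mul_comm]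
  have hH : (mlog Q - t • Matrix.diagonal d).IsHermitian := by
    refine (isHermitian_mlog Q).sub ?_
    rw [← Matrix.diagonal_smul]
    exact Matrix.isHermitian_diagonal _
  rw [← mlog_exp hH]
  congr 1
  rw [h1.eq, mul_assoc, expDiag_mul, sub_eq_add_neg, ← neg_smul, Matrix.exp_add_of_commute,
    exp_mlog hQ, exp_smul_diagonal]
  · congr 2; ring
  · exact (hc.smul_left (-t)).symm

/-- The block diagonal part of `L` with respect to the level sets of `d`. -/
noncomputable def levelPart (d : Fin n → ℝ) (L : Matrix (Fin n) (Fin n) ℝ) : Matrix (Fin n) (Fin n) ℝ :=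
  Matrix.of fun i j => if d i = d j then L i j else 0

/-- Entry `(i, j)` is scaled by `e^{-(d i - d j) t / 2}`. Growth requires `d i < d j`, hence `i <
j`, where `L` vanishes. -/
theorem tendsto_conj_expDiag {d : Fin n → ℝ} (hd : Monotone d) {L : Matrix (Fin n) (Fin n) ℝ}
    (hL : ∀ i j, i < j → L i j = 0) :
    Tendsto (fun t => expDiag d (-t / 2) * L * expDiag d (t / 2)) atTop
      (𝓝 (levelPart d L)) := by
  refine tendsto_pi_nhds.2 fun i => tendsto_pi_nhds.2 fun j => ?_
  have h0 : ∀ t, (expDiag d (-t / 2) * L * expDiag d (t / 2)) i j =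
      L i j * Real.exp (-((d i - d j) / 2 * t)) := by
    intro t
    simp only [expDiag, Matrix.diagonal_mul, Matrix.mul_diagonal]
    rw [mul_comm (Real.exp _), mul_assoc, ← Real.exp_add]
    congr 2; ring
  simp only [h0, levelPart, Matrix.of_apply]
  split_ifs with h
  · simp [h]
  rcases lt_or_gt_of_ne h with h | h
  · have : i < j := by
      by_contra hij
      exact absurd (hd (not_lt.1 hij)) (not_le.2 h)
    simp [hL i j this]
  · have : Tendsto (fun t : ℝ => (d i - d j) / 2 * t) atTop atTop :=
      tendsto_id.const_mul_atTop (by linarith)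
    simpa using (Real.tendsto_exp_neg_atTop_nhds_zero.comp this).const_mul (L i j)

theorem tendsto_sqrt_trace_mlog_sq {d : Fin n → ℝ} (hd : Monotone d) (hd0 : 0 < ∑ j, d j ^ 2)
    {L : Matrix (Fin n) (Fin n) ℝ} (hL : ∀ i j, i < j → L i j = 0) (hL0 : ∀ i, 0 < L i i) :
    Tendsto (fun t => Real.sqrt (mlog (L.transpose * expDiag d (-t) * L) ^ 2).trace -
      Real.sqrt (∑ j, d j ^ 2) * t) atTop
      (𝓝 (-(2 * ∑ j, d j * Real.log (L j j)) / Real.sqrt (∑ j, d j ^ 2))) := by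
  set N := levelPart d L with hN
  have hNl : ∀ i j, i < j → N i j = 0 := fun i j hij => by simp [hN, levelPart, hL i j hij]
  have hNd : ∀ i, N i i = L i i := fun i => by simp [hN, levelPart]
  have hN0 : ∀ i, 0 < N i i := fun i => by rw [hNd]; exact hL0 i
  have hNdet : N.det ≠ 0 := by
    rw [det_eq_prod_of_lower hNl]
    exact (Finset.prod_pos fun i _ => hN0 i).ne'
  have hNu : IsUnit N.det := hNdet.isUnit
  have hNtu : IsUnit N.transpose.det := by rwa [Matrix.det_transpose]
  have hNb : ∀ i j, d i ≠ d j → N i j = 0 := fun i j h => by simp [hN, levelPart, h]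
  have hcN : Commute (Matrix.diagonal d) N := by
    ext i j
    simp only [Matrix.diagonal_mul, Matrix.mul_diagonal]
    by_cases h : d i = d j
    · rw [h, mul_comm]
    · simp [hNb i j h]
  have hcNt : Commute (Matrix.diagonal d) N.transpose := by
    simpa [Commute, SemiconjBy, eq_comm] using congrArg Matrix.transpose hcN.eq
  set Q := N.transpose * N with hQ
  have hQp : Q.PosDef := posDef_transpose_mul_self hNdet
  have hcQ : Commute (Matrix.diagonal d) Q := hcNt.mul_right hcN
  -- `R` is chosen so that `R t * F t = e^{-tD/2} L` while `R t → N N⁻¹ = 1`; the perturbation is `K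
  -- = Rᵀ R`.
  set R : ℝ → Matrix (Fin n) (Fin n) ℝ :=
    fun t => expDiag d (-t / 2) * L * expDiag d (t / 2) * N⁻¹ with hR
  have hRlim : Tendsto R atTop (𝓝 1) := by
    have h := (tendsto_conj_expDiag hd hL).mul_const N⁻¹
    rwa [← hN, Matrix.mul_nonsing_inv N hNu] at h
  have hK : Tendsto (fun t => (R t).transpose * R t) atTop (𝓝 1) := by
    have h := ((continuous_id.matrix_transpose.tendsto 1).comp hRlim).mul hRlim
    simpa [Function.comp_def] using h
  set F : ℝ → Matrix (Fin n) (Fin n) ℝ := fun t => N * expDiag d (-t / 2) with hF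
  have hFu : ∀ t, IsUnit (F t) := fun t =>
    ((Matrix.isUnit_iff_isUnit_det N).2 hNu).mul (isUnit_expDiag d _)
  have hherm : ∀ M : Matrix (Fin n) (Fin n) ℝ, (M.transpose * M).IsHermitian := fun M => by
    simpa using Matrix.isHermitian_conjTranspose_mul_self M
  have hRF : ∀ t, R t * F t = expDiag d (-t / 2) * L := fun t => by
    simp only [hR, hF]
    rw [mul_assoc (expDiag d (-t / 2) * L * _), ← mul_assoc N⁻¹, Matrix.nonsing_inv_mul N hNu,
      one_mul, mul_assoc, expDiag_mul, show t / 2 + -t / 2 = 0 by ring, expDiag_zero, mul_one]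
  have hFKF : ∀ t, (F t).transpose * ((R t).transpose * R t) * F t =
      L.transpose * expDiag d (-t) * L := fun t => by
    rw [show (F t).transpose * ((R t).transpose * R t) * F t =
      (R t * F t).transpose * (R t * F t) by simp [Matrix.transpose_mul, mul_assoc], hRF,
      Matrix.transpose_mul, transpose_expDiag, mul_assoc, ← mul_assoc (expDiag d _),
      expDiag_mul, show -t / 2 + -t / 2 = -t by ring, mul_assoc]
  have hFF : ∀ t, (F t).transpose * F t = expDiag d (-t / 2) * Q * expDiag d (-t / 2) := fun t => by
    simp [hF, hQ, transpose_expDiag, mul_assoc]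
  have key := tendsto_mlog_conjugate_sub_mlog hK (fun t => hherm (R t)) hFu
  simp only [hFKF, hFF, mlog_conjugate_expDiag d hQp hcQ] at key
  have key2 := tendsto_sqrt_trace_sq_sub (fun t => isHermitian_mlog _) (fun t => by
    rw [← mlog_conjugate_expDiag d hQp hcQ]; exact isHermitian_mlog _) key
  have htr : ∀ t : ℝ, ((mlog Q - t • Matrix.diagonal d) ^ 2).trace = (mlog Q ^ 2).trace -
      2 * (2 * ∑ j, d j * Real.log (L j j)) * t + (∑ j, d j ^ 2) * t ^ 2 := fun t => by
    have h1 := trace_diagonal_mul_mlog hNl hN0 hNb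
    simp only [← hQ, hNd] at h1
    have h2 : (mlog Q * Matrix.diagonal d).trace = 2 * ∑ j, d j * Real.log (L j j) := by
      rw [Matrix.trace_mul_comm, h1]
    have h3 : (Matrix.diagonal d * Matrix.diagonal d).trace = ∑ j, d j ^ 2 := by
      simp [Matrix.diagonal_mul_diagonal, Matrix.trace, pow_two]
    simp only [pow_two (_ - _), mul_sub, sub_mul, Matrix.trace_sub, Matrix.smul_mul, Matrix.mul_smul,
      Matrix.trace_smul, h1, h2, h3, smul_eq_mul, pow_two (mlog Q)]
    ring
  have hpos : ∀ t : ℝ, 0 ≤ (mlog Q ^ 2).trace -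
      2 * (2 * ∑ j, d j * Real.log (L j j)) * t + (∑ j, d j ^ 2) * t ^ 2 := fun t => by
    rw [← htr, ← mlog_conjugate_expDiag d hQp hcQ, ← hFF, trace_mlog_sq (hherm _)]
    positivity
  have key3 := key2.add (tendsto_sqrt_quadratic_sub hd0 hpos)
  rw [zero_add] at key3
  refine key3.congr fun t => ?_
  rw [htr]
  ring

end SPDBusemann

/-! ### Block indices and existence of the Cholesky factor -/

namespace SPDBusemann

variable {n k : ℕ}

theorem partialSum_zero (m : Fin k → ℕ) : partialSum m 0 = 0 := by
  simp [partialSum]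

theorem partialSum_succ (m : Fin k → ℕ) (i : Fin k) :
    partialSum m (i.val + 1) = partialSum m i.val + m i := by
  have : (Finset.univ.filter fun l : Fin k => l.val < i.val + 1) =
      insert i (Finset.univ.filter fun l : Fin k => l.val < i.val) := by
    ext l
    simp only [Finset.mem_filter, Finset.mem_univ, true_and, Finset.mem_insert, Fin.ext_iff]
    omega
  rw [partialSum, this, Finset.sum_insert (by simp), add_comm, partialSum]

theorem partialSum_mono (m : Fin k → ℕ) : Monotone (partialSum m) := fun i j hij =>
  Finset.sum_le_sum_of_subset fun l hl => by
    simp only [Finset.mem_filter, Finset.mem_univ, true_and] at hl ⊢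
    omega

theorem partialSum_of_le (m : Fin k → ℕ) {i : ℕ} (hi : k ≤ i) : partialSum m i = ∑ l, m l := by
  rw [partialSum, Finset.filter_true_of_mem]
  intro l _
  omega

theorem mem_block {m : Fin k → ℕ} {i : Fin k} {j : Fin n} :
    j ∈ block n m i ↔ partialSum m i.val ≤ j.val ∧ j.val < partialSum m (i.val + 1) := by
  simp [block]

theorem exists_mem_block {m : Fin k → ℕ} (hm : ∑ i, m i = n) (j : Fin n) :
    ∃ i, j ∈ block n m i := by
  classical
  -- The block of `j` precedes the least `p` with `j < α_p`; this `p` is positive because `α_0 = 0`.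
  have h : ∃ p, j.val < partialSum m p := ⟨k, by rw [partialSum_of_le m le_rfl, hm]; exact j.2⟩
  obtain ⟨p, hp⟩ : ∃ p, Nat.find h = p + 1 := Nat.exists_eq_succ_of_ne_zero fun h0 => by
    have := Nat.find_spec h
    rw [h0, partialSum_zero] at this
    omega
  have hpk : p < k := by
    have : Nat.find h ≤ k :=
      Nat.find_min' h (by rw [partialSum_of_le m le_rfl, hm]; exact j.2)
    omega
  refine ⟨⟨p, hpk⟩, mem_block.2 ⟨not_lt.1 (Nat.find_min h (hp ▸ Nat.lt_succ_self p)), ?_⟩⟩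
  have := Nat.find_spec h
  rwa [hp] at this

theorem le_of_mem_block {m : Fin k → ℕ} {i i' : Fin k} {j j' : Fin n} (hj : j ∈ block n m i)
    (hj' : j' ∈ block n m i') (h : j ≤ j') : i ≤ i' := by
  by_contra hi
  have h1 : partialSum m (i'.val + 1) ≤ partialSum m i.val := partialSum_mono m (not_le.1 hi)
  have := (mem_block.1 hj).1
  have := (mem_block.1 hj').2
  have : j.val ≤ j'.val := h
  omega

/-- The diagonal entries of `blockDiag n m lam`. -/
noncomputable def blockEntry (n : ℕ) (m : Fin k → ℕ) (lam : Fin k → ℝ) (j : Fin n) : ℝ :=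
  ∑ i : Fin k, if j ∈ block n m i then lam i else 0

theorem blockDiag_eq_diagonal (m : Fin k → ℕ) (lam : Fin k → ℝ) :
    blockDiag n m lam = Matrix.diagonal (blockEntry n m lam) := rfl

theorem blockEntry_of_mem {m : Fin k → ℕ} {lam : Fin k → ℝ} {i : Fin k} {j : Fin n}
    (hj : j ∈ block n m i) : blockEntry n m lam j = lam i := by
  rw [blockEntry, Finset.sum_eq_single i]
  · simp [hj]
  · intro i' _ hi'
    rw [if_neg fun h => hi' (le_antisymm (le_of_mem_block h hj le_rfl)
      (le_of_mem_block hj h le_rfl))]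
  · simp

theorem monotone_blockEntry {m : Fin k → ℕ} (hm : ∑ i, m i = n) {lam : Fin k → ℝ}
    (hlam : Monotone lam) : Monotone (blockEntry n m lam) := fun j j' h => by
  obtain ⟨i, hi⟩ := exists_mem_block hm j
  obtain ⟨i', hi'⟩ := exists_mem_block hm j'
  rw [blockEntry_of_mem hi, blockEntry_of_mem hi']
  exact hlam (le_of_mem_block hi hi' h)

theorem sum_blockEntry_mul (m : Fin k → ℕ) (lam : Fin k → ℝ) (f : Fin n → ℝ) :
    ∑ j, blockEntry n m lam j * f j = ∑ i, ∑ j ∈ block n m i, lam i * f j := by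
  simp only [blockEntry, Finset.sum_mul]
  rw [Finset.sum_comm]
  refine Finset.sum_congr rfl fun i _ => ?_
  simp [ite_mul, block, Finset.sum_filter]

theorem card_block {m : Fin k → ℕ} (hm : ∑ i, m i = n) (i : Fin k) : (block n m i).card = m i := by
  have hle : partialSum m (i.val + 1) ≤ n := by
    rw [← hm, ← partialSum_of_le m le_rfl]
    exact partialSum_mono m i.2
  have : (block n m i).map Fin.valEmbedding =
      Finset.Ico (partialSum m i.val) (partialSum m (i.val + 1)) := by
    ext a
    simp only [Finset.mem_map, mem_block, Fin.valEmbedding_apply, Finset.mem_Ico]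
    constructor
    · rintro ⟨j, hj, rfl⟩
      exact hj
    · intro ha
      exact ⟨⟨a, by omega⟩, ha, rfl⟩
  rw [← Finset.card_map Fin.valEmbedding, this, Nat.card_Ico, partialSum_succ]
  omega

theorem sum_blockEntry_sq {m : Fin k → ℕ} (hm : ∑ i, m i = n) (lam : Fin k → ℝ) :
    ∑ j, blockEntry n m lam j ^ 2 = ∑ i, (m i : ℝ) * lam i ^ 2 := by
  simp only [pow_two]
  rw [sum_blockEntry_mul]
  refine Finset.sum_congr rfl fun i _ => ?_
  rw [Finset.sum_congr rfl fun j hj => by rw [blockEntry_of_mem hj], Finset.sum_const,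
    card_block hm, nsmul_eq_mul]

theorem exists_isCholesky {Z : Matrix (Fin n) (Fin n) ℝ} (hZ : Z.PosDef) :
    ∃ L, IsCholesky Z L := by
  obtain ⟨T, hT⟩ : ∃ T, T = LDL.lower hZ := ⟨_, rfl⟩
  have hTl : ∀ i j, i < j → T i j = 0 := fun i j hij => hT ▸
    Matrix.blockTriangular_inv_of_blockTriangular (M := LDL.lowerInv hZ) (b := OrderDual.toDual)
      (fun a b hab => LDL.lowerInv_triangular hZ hab) hij
  have hTeq : T * LDL.diag hZ * T.transpose = Z := by
    rw [← Matrix.conjTranspose_eq_transpose_of_trivial]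
    exact hT ▸ LDL.lower_conj_diag hZ
  have hTdet : T.det ≠ 0 := fun h => hZ.det_pos.ne' (by rw [← hTeq]; simp [h])
  have hT0 : ∀ i, T i i ≠ 0 := fun i hi => hTdet (by
    rw [det_eq_prod_of_lower hTl]
    exact Finset.prod_eq_zero (Finset.mem_univ i) hi)
  have hD : ∀ i, 0 < LDL.diagEntries hZ i := by
    have h : (LDL.diag hZ).PosDef := by
      rw [LDL.diag_eq_lowerInv_conj]
      refine hZ.mul_mul_conjTranspose_same ?_
      exact Matrix.vecMul_injective_of_isUnit (isUnit_of_invertible _)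
    exact Matrix.posDef_diagonal_iff.1 h
  -- The signs make the diagonal of the factor positive and square to `1`, so only `T j j ≠ 0` is
  -- needed.
  refine ⟨T * Matrix.diagonal fun j =>
    Real.sqrt (LDL.diagEntries hZ j) * (SignType.sign (T j j) : ℝ), ?_, ?_, ?_⟩
  · intro i j hij
    simp [Matrix.mul_diagonal, hTl i j hij]
  · intro i
    rw [Matrix.mul_diagonal, mul_left_comm, self_mul_sign]
    exact mul_pos (Real.sqrt_pos.2 (hD i)) (abs_pos.2 (hT0 i))
  · rw [Matrix.transpose_mul, Matrix.diagonal_transpose, mul_assoc, ← mul_assoc (Matrix.diagonal _),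
      Matrix.diagonal_mul_diagonal, ← mul_assoc]
    refine hTeq.symm.trans ?_
    rw [LDL.diag]
    congr 3
    ext j
    rw [mul_mul_mul_comm, Real.mul_self_sqrt (hD j).le]
    rcases lt_or_gt_of_ne (hT0 j) with h | h
    · simp [sign_neg h]
    · simp [sign_pos h]

end SPDBusemann

/-! ### Leading minors: differentiation and triangular congruence -/

namespace SPDBusemann

variable {n : ℕ}

section
open scoped Matrix.Norms.Elementwise

theorem differentiable_det :
    Differentiable ℝ (fun M : Matrix (Fin n) (Fin n) ℝ => M.det) := by
  have h : ∀ i j, Differentiable ℝ (fun M : Matrix (Fin n) (Fin n) ℝ => M i j) := fun i j =>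
    (Matrix.entryLinearMap ℝ ℝ i j).toContinuousLinearMap.differentiable
  simp only [Matrix.det_apply']
  exact Differentiable.fun_sum fun σ _ => Differentiable.const_mul (fun M =>
    (HasFDerivAt.finsetProd fun i _ => (h _ _ M).hasFDerivAt).differentiableAt) _

theorem hasFDerivAt_det_one :
    HasFDerivAt (fun M : Matrix (Fin n) (Fin n) ℝ => M.det)
      (Matrix.traceLinearMap (Fin n) ℝ ℝ).toContinuousLinearMap 1 := by
  have h := (differentiable_det (n := n) 1).hasFDerivAt
  refine h.congr_fderiv (ContinuousLinearMap.ext fun H => ?_)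
  have h1 : HasDerivAt (fun r : ℝ => (1 + r • H).det)
      (fderiv ℝ (fun M : Matrix (Fin n) (Fin n) ℝ => M.det) 1 H) 0 := by
    have h2 : HasDerivAt (fun r : ℝ => 1 + r • H) H 0 := by
      have h3 := ((hasDerivAt_id (0 : ℝ)).smul_const H).const_add 1
      rw [one_smul] at h3
      exact h3
    have h' : HasFDerivAt (fun M : Matrix (Fin n) (Fin n) ℝ => M.det)
        (fderiv ℝ (fun M : Matrix (Fin n) (Fin n) ℝ => M.det) 1) (1 + (0 : ℝ) • H) := by
      rw [zero_smul, add_zero]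
      exact h
    exact h'.comp_hasDerivAt (0 : ℝ) h2
  refine h1.unique ?_
  -- `q` is the remainder in `det (1 + r H) = 1 + r tr H + r² q(r)`.
  set q := (Matrix.det (1 + (Polynomial.X : Polynomial ℝ) • H.map Polynomial.C)).divX.divX with hq
  have h3 := ((hasDerivAt_id (0 : ℝ)).const_mul H.trace).const_add 1
  have h4 := (q.hasDerivAt 0).mul ((hasDerivAt_id (0 : ℝ)).pow 2)
  have h5 := h3.add h4
  rw [show H.trace * 1 + _ = H.trace by simp] at h5
  refine h5.congr_of_eventuallyEq (Eventually.of_forall fun r => ?_)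
  simp [Matrix.det_one_add_smul r H, hq]

/-- The matrix that agrees with `W` on `s × s` and with the identity elsewhere. -/
noncomputable def compression (s : Finset (Fin n)) (W : Matrix (Fin n) (Fin n) ℝ) :
    Matrix (Fin n) (Fin n) ℝ :=
  coordProj s * W * coordProj s + (1 - coordProj s)

theorem compression_one (s : Finset (Fin n)) : compression s 1 = 1 := by
  simp [compression, coordProj_mul_self]

theorem trace_compression (s : Finset (Fin n)) (H : Matrix (Fin n) (Fin n) ℝ) :
    (coordProj s * H * coordProj s).trace = ∑ j ∈ s, H j j := by
  simp [Matrix.trace, coordProj, Matrix.mul_diagonal]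

theorem exists_hasFDerivAt_log_det_compression (s : Finset (Fin n)) :
    ∃ f' : Matrix (Fin n) (Fin n) ℝ →L[ℝ] ℝ,
      HasFDerivAt (fun W : Matrix (Fin n) (Fin n) ℝ => Real.log (compression s W).det) f' 1 ∧
        ∀ H, f' H = ∑ j ∈ s, H j j := by
  set Φ : Matrix (Fin n) (Fin n) ℝ →L[ℝ] Matrix (Fin n) (Fin n) ℝ :=
    ((LinearMap.mulRight ℝ (coordProj s)).comp
      (LinearMap.mulLeft ℝ (coordProj s))).toContinuousLinearMap
  have h1 : HasFDerivAt (compression s) Φ 1 := Φ.hasFDerivAt.add_const _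
  have h2 : HasFDerivAt (fun M : Matrix (Fin n) (Fin n) ℝ => M.det)
      (Matrix.traceLinearMap (Fin n) ℝ ℝ).toContinuousLinearMap (compression s 1) := by
    rw [compression_one]
    exact hasFDerivAt_det_one
  refine ⟨_, (h2.comp 1 h1).log (by simp [compression_one]), fun H => ?_⟩
  rw [← trace_compression, Function.comp_apply, compression_one, Matrix.det_one, inv_one, one_smul]
  rfl

/-- The weighted sum `∑ d_j (log Δ_{j+1} - log Δ_j)` of logarithms of quotients of consecutive
leading principal minors. -/
noncomputable def minorSum (d : Fin n → ℝ) (W : Matrix (Fin n) (Fin n) ℝ) : ℝ :=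
  ∑ j, d j * (Real.log (compression (Finset.Iic j) W).det -
    Real.log (compression (Finset.Iio j) W).det)

theorem sum_Iic_sub_sum_Iio (f : Fin n → ℝ) (j : Fin n) :
    ∑ i ∈ Finset.Iic j, f i - ∑ i ∈ Finset.Iio j, f i = f j := by
  rw [← Finset.Iio_insert, Finset.sum_insert (by simp), add_sub_cancel_right]

theorem exists_hasFDerivAt_sum_mul_sub {E ι : Type*} [NormedAddCommGroup E] [NormedSpace ℝ E]
    [Fintype ι] (d : ι → ℝ) {F G : ι → E → ℝ} {f g : ι → E →L[ℝ] ℝ} {x : E}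
    (hF : ∀ i, HasFDerivAt (F i) (f i) x) (hG : ∀ i, HasFDerivAt (G i) (g i) x) :
    ∃ f' : E →L[ℝ] ℝ, HasFDerivAt (fun y => ∑ i, d i * (F i y - G i y)) f' x ∧
      ∀ v, f' v = ∑ i, d i * (f i v - g i v) :=
  ⟨_, HasFDerivAt.fun_sum fun i _ => ((hF i).sub (hG i)).const_mul (d i), fun v => by simp⟩

/-- At the identity the derivative of each log-minor is a partial trace, and consecutive partial
traces differ by `H j j`. -/
theorem exists_hasFDerivAt_minorSum (d : Fin n → ℝ) :
    ∃ f' : Matrix (Fin n) (Fin n) ℝ →L[ℝ] ℝ,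
      HasFDerivAt (minorSum d) f' 1 ∧ ∀ H, f' H = (Matrix.diagonal d * H).trace := by
  choose f' hf hf' using exists_hasFDerivAt_log_det_compression (n := n)
  obtain ⟨g, hg, hg'⟩ := exists_hasFDerivAt_sum_mul_sub d
    (fun j => hf (Finset.Iic j)) (fun j => hf (Finset.Iio j))
  refine ⟨g, hg, fun H => (hg' H).trans ?_⟩
  rw [Matrix.trace]
  refine Finset.sum_congr rfl fun j _ => ?_
  refine (congrArg (d j * ·) (congrArg₂ (· - ·) (hf' _ H) (hf' _ H))).trans ?_
  rw [sum_Iic_sub_sum_Iio fun i => H i i, Matrix.diag_apply, Matrix.diagonal_mul]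

end

/-- `s` is an initial segment, so lower triangular matrices leave the complementary coordinate
subspace invariant. -/
theorem coordProj_mul_of_lower {s : Finset (Fin n)} (hs : ∀ i ∈ s, ∀ j, j ≤ i → j ∈ s)
    {L : Matrix (Fin n) (Fin n) ℝ} (hL : ∀ i j, i < j → L i j = 0) :
    coordProj s * L = coordProj s * L * coordProj s := by
  ext i j
  simp only [coordProj, Matrix.diagonal_mul, Matrix.mul_diagonal]
  by_cases hi : i ∈ s
  · by_cases hj : j ∈ s
    · simp [hj]
    · simp [hL i j (not_le.1 fun h => hj (hs i hi j h))]
  · simp [hi]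

/-- For an initial segment, `E L = E L E` with `E` the projection, so compression is multiplicative
on `L W Lᵀ`. -/
theorem det_compression_conj {s : Finset (Fin n)} (hs : ∀ i ∈ s, ∀ j, j ≤ i → j ∈ s)
    {L : Matrix (Fin n) (Fin n) ℝ} (hL : ∀ i j, i < j → L i j = 0)
    (W : Matrix (Fin n) (Fin n) ℝ) :
    (compression s (L * W * L.transpose)).det =
      (∏ j ∈ s, L j j) * (compression s W).det * ∏ j ∈ s, L j j := by
  have hE := coordProj_mul_self s
  have hc := coordProj_mul_of_lower hs hL
  have hct : L.transpose * coordProj s = coordProj s * L.transpose * coordProj s := by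
    simpa [transpose_coordProj, mul_assoc] using congrArg Matrix.transpose hc
  have hM : compression s L = coordProj s * L + (1 - coordProj s) := by rw [compression, ← hc]
  have hMt : (compression s L).transpose = L.transpose * coordProj s + (1 - coordProj s) := by
    rw [hM]; simp [transpose_coordProj]
  have hdet : (compression s L).det = ∏ j ∈ s, L j j := det_compression_of_lower hL s
  have key : compression s (L * W * L.transpose) =
      compression s L * compression s W * (compression s L).transpose := by
    rw [hMt, hM]
    simp only [compression]
    have h3 : coordProj s * (1 - coordProj s) = 0 := by rw [mul_sub, hE, mul_one, sub_self]
    have h4 : (1 - coordProj s) * coordProj s = 0 := by rw [sub_mul, hE, one_mul, sub_self]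
    have h5 : (1 - coordProj s) * (1 - coordProj s) = 1 - coordProj s := by
      rw [mul_sub, h4, mul_one, sub_zero]
    generalize 1 - coordProj s = E' at *
    generalize coordProj s = E at *
    generalize L.transpose = M at *
    have a1 : (E * L + E') * (E * W * E + E') = E * L * W * E + E' := by
      have b1 : E * L * (E * W * E) = E * L * W * E := by
        rw [← mul_assoc, ← mul_assoc, ← hc]
      have b2 : E * L * E' = 0 := by rw [hc, mul_assoc, h3, mul_zero]
      have b3 : E' * (E * W * E) = 0 := by rw [← mul_assoc, ← mul_assoc, h4, zero_mul, zero_mul]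
      rw [add_mul, mul_add, mul_add, b1, b2, b3, h5]
      simp
    rw [a1, add_mul, mul_add, mul_add, h5, mul_assoc _ E E', h3, ← mul_assoc E', hct]
    have b4 : E' * (E * M * E) = 0 := by rw [← mul_assoc, ← mul_assoc, h4, zero_mul, zero_mul]
    have b5 : E * L * W * E * (E * M * E) = E * (L * W * M) * E := by
      rw [mul_assoc _ E (E * M * E), ← mul_assoc E (E * M) E, ← mul_assoc E E M, hE, ← hct]
      simp only [mul_assoc]
    rw [mul_assoc E' M E, hct, b4, b5]
    simp
  rw [key, Matrix.det_mul, Matrix.det_mul, Matrix.det_transpose, hdet]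

theorem minorSum_conj {d : Fin n → ℝ} {L : Matrix (Fin n) (Fin n) ℝ}
    (hL : ∀ i j, i < j → L i j = 0) (hL0 : ∀ i, 0 < L i i) {W : Matrix (Fin n) (Fin n) ℝ}
    (hW : ∀ s, (∀ i ∈ s, ∀ j, j ≤ i → j ∈ s) → (compression s W).det ≠ 0) :
    minorSum d (L * W * L.transpose) = 2 * ∑ j, d j * Real.log (L j j) + minorSum d W := by
  have h : ∀ s : Finset (Fin n), (∀ i ∈ s, ∀ j, j ≤ i → j ∈ s) →
      Real.log (compression s (L * W * L.transpose)).det =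
        2 * ∑ j ∈ s, Real.log (L j j) + Real.log (compression s W).det := fun s hs => by
    have hp : ∏ j ∈ s, L j j ≠ 0 := (Finset.prod_pos fun i _ => hL0 i).ne'
    rw [det_compression_conj hs hL, Real.log_mul (mul_ne_zero hp (hW s hs)) hp,
      Real.log_mul hp (hW s hs), Real.log_prod fun i _ => (hL0 i).ne']
    ring
  rw [minorSum, minorSum, Finset.mul_sum, ← Finset.sum_add_distrib]
  refine Finset.sum_congr rfl fun j _ => ?_
  have h1 := h (Finset.Iic j) fun a ha b hb => Finset.mem_Iic.2 (hb.trans (Finset.mem_Iic.1 ha))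
  have h2 := h (Finset.Iio j) fun a ha b hb =>
    Finset.mem_Iio.2 (hb.trans_lt (Finset.mem_Iio.1 ha))
  rw [h1, h2, ← sum_Iic_sub_sum_Iio (fun i => Real.log (L i i)) j]
  ring

theorem minorSum_mul_transpose {d : Fin n → ℝ} {L : Matrix (Fin n) (Fin n) ℝ}
    (hL : ∀ i j, i < j → L i j = 0) (hL0 : ∀ i, 0 < L i i) :
    minorSum d (L * L.transpose) = 2 * ∑ j, d j * Real.log (L j j) := by
  have h := minorSum_conj (d := d) (W := 1) hL hL0 fun s _ => by simp [compression_one]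
  simpa [minorSum, compression_one] using h

theorem minorSum_conj_of_posDef {d : Fin n → ℝ} {L : Matrix (Fin n) (Fin n) ℝ}
    (hL : ∀ i j, i < j → L i j = 0) (hL0 : ∀ i, 0 < L i i) {W : Matrix (Fin n) (Fin n) ℝ}
    (hW : W.PosDef) :
    minorSum d (L * W * L.transpose) = 2 * ∑ j, d j * Real.log (L j j) + minorSum d W := by
  refine minorSum_conj hL hL0 fun s hs => ?_
  obtain ⟨M, hM⟩ := exists_isCholesky hW
  -- By Cholesky, each leading minor of `W` is the square of a product of positive diagonal entries,
  -- hence nonzero.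
  have h := det_compression_conj hs hM.lower 1
  rw [mul_one, ← hM.eq, compression_one, Matrix.det_one, mul_one] at h
  have hp : 0 < ∏ j ∈ s, M j j := Finset.prod_pos fun i _ => hM.diag_pos i
  rw [h]
  positivity

end SPDBusemann

/-! ### Reduction to normal form, value and gradient -/

namespace SPDBusemann

variable {n : ℕ}

theorem msqrt_mul_msqrt {Y : Matrix (Fin n) (Fin n) ℝ} (hY : Y.PosDef) :
    msqrt Y * msqrt Y = Y := by
  have hs : IsSelfAdjoint Y := hY.isHermitian
  have hc : ContinuousOn Real.sqrt (spectrum ℝ Y) := Y.finite_real_spectrum.continuousOn _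
  rw [msqrt, ← cfc_mul Real.sqrt Real.sqrt Y hc hc]
  conv_rhs => rw [← cfc_id ℝ Y hs]
  refine cfc_congr fun x hx => ?_
  rw [hY.isHermitian.spectrum_real_eq_range_eigenvalues] at hx
  obtain ⟨i, rfl⟩ := hx
  exact Real.mul_self_sqrt (hY.eigenvalues_pos i).le

theorem transpose_msqrt (Y : Matrix (Fin n) (Fin n) ℝ) : (msqrt Y).transpose = msqrt Y := by
  have h : (msqrt Y).IsHermitian := cfc_predicate Real.sqrt Y
  rw [← Matrix.conjTranspose_eq_transpose_of_trivial, h]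

theorem isUnit_det_msqrt {Y : Matrix (Fin n) (Fin n) ℝ} (hY : Y.PosDef) :
    IsUnit (msqrt Y).det := by
  refine IsUnit.mk0 _ fun h => hY.det_pos.ne' ?_
  rw [← msqrt_mul_msqrt hY, Matrix.det_mul, h, zero_mul]

theorem transpose_minvsqrt (Y : Matrix (Fin n) (Fin n) ℝ) :
    (minvsqrt Y).transpose = minvsqrt Y := by
  rw [minvsqrt, Matrix.transpose_nonsing_inv, transpose_msqrt]

theorem minvsqrt_mul_minvsqrt {Y : Matrix (Fin n) (Fin n) ℝ} (hY : Y.PosDef) :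
    minvsqrt Y * minvsqrt Y = Y⁻¹ := by
  rw [minvsqrt, ← Matrix.mul_inv_rev, msqrt_mul_msqrt hY]

/-- `W^{-1/2} X W^{-1/2}` and `X W⁻¹` differ by a cyclic permutation of factors, so any Hermitian
`A` with that spectrum computes the distance. -/
theorem spdDist_eq_of_charpoly_eq {X W A : Matrix (Fin n) (Fin n) ℝ} (hX : X.IsHermitian)
    (hW : W.PosDef) (hA : A.IsHermitian) (h : A.charpoly = (X * W⁻¹).charpoly) :
    spdDist X W = Real.sqrt (mlog A ^ 2).trace := by
  rw [spdDist, trace_mlog_sq_eq_of_charpoly_eq _ hA]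
  · rw [h, mul_assoc, Matrix.charpoly_mul_comm, mul_assoc, minvsqrt_mul_minvsqrt hW]
  · have := Matrix.isHermitian_mul_mul_conjTranspose (minvsqrt W) hX
    rwa [Matrix.conjTranspose_eq_transpose_of_trivial, transpose_minvsqrt] at this

/-- The ray `t ↦ exp_Y(tV)` in terms of `P = Y^{1/2} U`. -/
theorem spdExp_smul {Y V U : Matrix (Fin n) (Fin n) ℝ} {d : Fin n → ℝ}
    (hU : U * U.transpose = 1)
    (hV : minvsqrt Y * V * minvsqrt Y = U * Matrix.diagonal d * U.transpose) (t : ℝ) :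
    spdExp Y (t • V) = (msqrt Y * U) * expDiag d t * (msqrt Y * U).transpose := by
  have hUi : U⁻¹ = U.transpose := Matrix.inv_eq_right_inv hU
  have hUu : IsUnit U := IsUnit.of_mul_eq_one _ hU
  rw [spdExp, Matrix.mul_smul, Matrix.smul_mul, hV, ← exp_smul_diagonal, Matrix.transpose_mul,
    transpose_msqrt, ← hUi, ← Matrix.smul_mul, ← Matrix.mul_smul, Matrix.exp_conj U _ hUu]
  simp only [mul_assoc]

theorem spdDist_conj_expDiag {P L : Matrix (Fin n) (Fin n) ℝ} (d : Fin n → ℝ) (t : ℝ)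
    (hP : IsUnit P.det) :
    spdDist (P * (L * L.transpose) * P.transpose) (P * expDiag d t * P.transpose) =
      Real.sqrt (mlog (L.transpose * expDiag d (-t) * L) ^ 2).trace := by
  have hPt : IsUnit P.transpose.det := by rwa [Matrix.det_transpose]
  have hE : (expDiag d t)⁻¹ = expDiag d (-t) :=
    Matrix.inv_eq_right_inv (by rw [expDiag_mul, add_neg_cancel, expDiag_zero])
  refine spdDist_eq_of_charpoly_eq ?_ ?_ ?_ ?_
  · have := Matrix.isHermitian_mul_mul_conjTranspose P (Matrix.isHermitian_mul_conjTranspose_self L)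
    simpa using this
  · have h : P * expDiag d t * P.transpose =
        (expDiag d (t / 2) * P.transpose).transpose * (expDiag d (t / 2) * P.transpose) := by
      rw [Matrix.transpose_mul, transpose_expDiag, Matrix.transpose_transpose,
        mul_assoc P (expDiag d (t / 2)), ← mul_assoc (expDiag d (t / 2)), expDiag_mul, add_halves,
        mul_assoc]
    rw [h]
    refine posDef_transpose_mul_self ?_
    rw [Matrix.det_mul]
    exact mul_ne_zero ((Matrix.isUnit_iff_isUnit_det _).1 (isUnit_expDiag d _)).ne_zero
      hPt.ne_zero
  · rw [Matrix.IsHermitian, Matrix.conjTranspose_eq_transpose_of_trivial]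
    simp [transpose_expDiag, mul_assoc]
  · rw [Matrix.mul_inv_rev, Matrix.mul_inv_rev, hE, mul_assoc L.transpose, Matrix.charpoly_mul_comm,
      ← mul_assoc (P * (L * L.transpose) * P.transpose), mul_assoc (P * (L * L.transpose)),
      Matrix.mul_nonsing_inv _ hPt, mul_one, ← mul_assoc, ← Matrix.charpoly_mul_comm P⁻¹,
      mul_assoc P, ← mul_assoc P⁻¹, Matrix.nonsing_inv_mul _ hP, one_mul, mul_assoc,
      Matrix.charpoly_mul_comm, mul_assoc]

theorem tnorm_eq {Y V U : Matrix (Fin n) (Fin n) ℝ} {d : Fin n → ℝ} (hY : Y.PosDef)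
    (hU : U * U.transpose = 1)
    (hV : minvsqrt Y * V * minvsqrt Y = U * Matrix.diagonal d * U.transpose) :
    tnorm Y V = Real.sqrt (∑ j, d j ^ 2) := by
  have hU' : U.transpose * U = 1 := mul_eq_one_comm.1 hU
  rw [tnorm, metric, ← minvsqrt_mul_minvsqrt hY]
  congr 1
  calc (minvsqrt Y * minvsqrt Y * V * (minvsqrt Y * minvsqrt Y) * V).trace
      = (minvsqrt Y * (minvsqrt Y * V * (minvsqrt Y * minvsqrt Y) * V)).trace := by
        simp only [mul_assoc]
    _ = ((minvsqrt Y * V * minvsqrt Y) * (minvsqrt Y * V * minvsqrt Y)).trace := by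
        rw [Matrix.trace_mul_comm]; simp only [mul_assoc]
    _ = (U * (Matrix.diagonal d * Matrix.diagonal d * U.transpose)).trace := by
        rw [hV, mul_assoc, mul_assoc, mul_assoc, ← mul_assoc U.transpose,
          hU', one_mul, mul_assoc]
    _ = ∑ j, d j ^ 2 := by
        rw [Matrix.trace_mul_comm, mul_assoc, hU', mul_one, Matrix.diagonal_mul_diagonal]
        simp [Matrix.trace, pow_two]

theorem tendsto_busemannAux {Y V U L : Matrix (Fin n) (Fin n) ℝ} {d : Fin n → ℝ} (hY : Y.PosDef)
    (hU : U * U.transpose = 1)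
    (hV : minvsqrt Y * V * minvsqrt Y = U * Matrix.diagonal d * U.transpose)
    (hd : Monotone d) (hd0 : 0 < ∑ j, d j ^ 2)
    (hL : ∀ i j, i < j → L i j = 0) (hL0 : ∀ i, 0 < L i i) :
    Tendsto (busemannAux Y V (msqrt Y * U * (L * L.transpose) * (msqrt Y * U).transpose)) atTop
      (𝓝 (-(2 * ∑ j, d j * Real.log (L j j)) / Real.sqrt (∑ j, d j ^ 2))) := by
  refine (tendsto_sqrt_trace_mlog_sq hd hd0 hL hL0).congr fun t => ?_
  rw [busemannAux, spdExp_smul hU hV, spdDist_conj_expDiag, tnorm_eq hY hU hV]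
  rw [Matrix.det_mul]
  exact (isUnit_det_msqrt hY).mul
    ((Matrix.isUnit_iff_isUnit_det U).1 (IsUnit.of_mul_eq_one _ hU))

section
open scoped Matrix.Norms.Elementwise

theorem exists_hasFDerivAt_conj {f : Matrix (Fin n) (Fin n) ℝ → ℝ}
    {f' : Matrix (Fin n) (Fin n) ℝ →L[ℝ] ℝ} {T X : Matrix (Fin n) (Fin n) ℝ}
    (hf : HasFDerivAt f f' (T * X * T.transpose)) (a c : ℝ) :
    ∃ g' : Matrix (Fin n) (Fin n) ℝ →L[ℝ] ℝ,
      HasFDerivAt (fun Z => c * (a + f (T * Z * T.transpose))) g' X ∧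
        ∀ H, g' H = c * f' (T * H * T.transpose) := by
  set Φ : Matrix (Fin n) (Fin n) ℝ →L[ℝ] Matrix (Fin n) (Fin n) ℝ :=
    ((LinearMap.mulRight ℝ T.transpose).comp (LinearMap.mulLeft ℝ T)).toContinuousLinearMap
  have h1 : HasFDerivAt (fun Z => T * Z * T.transpose) Φ X := Φ.hasFDerivAt
  exact ⟨_, ((HasFDerivAt.comp X hf h1).const_add a).const_mul c, fun H => rfl⟩

end

/-- This eliminates the Cholesky factor, leaving a function of `Z` whose differentiability is
visible. -/
theorem busemann_eq_minorSum {Y V U : Matrix (Fin n) (Fin n) ℝ} {d : Fin n → ℝ} (hY : Y.PosDef)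
    (hU : U * U.transpose = 1)
    (hV : minvsqrt Y * V * minvsqrt Y = U * Matrix.diagonal d * U.transpose)
    (hd : Monotone d) (hd0 : 0 < ∑ j, d j ^ 2) {Z : Matrix (Fin n) (Fin n) ℝ} (hZ : Z.PosDef) :
    busemann Y V (msqrt Y * U * Z * (msqrt Y * U).transpose) =
      -(1 / Real.sqrt (∑ j, d j ^ 2)) * minorSum d Z := by
  obtain ⟨L, hL⟩ := exists_isCholesky hZ
  rw [hL.eq, minorSum_mul_transpose hL.lower hL.diag_pos, busemann,
    (tendsto_busemannAux hY hU hV hd hd0 hL.lower hL.diag_pos).limUnder_eq]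
  ring

theorem hasRiemGrad_busemann {Y V U L : Matrix (Fin n) (Fin n) ℝ} {d : Fin n → ℝ} (hY : Y.PosDef)
    (hU : U * U.transpose = 1)
    (hV : minvsqrt Y * V * minvsqrt Y = U * Matrix.diagonal d * U.transpose)
    (hd : Monotone d) (hd0 : 0 < ∑ j, d j ^ 2)
    (hL : ∀ i j, i < j → L i j = 0) (hL0 : ∀ i, 0 < L i i) :
    HasRiemGrad (busemann Y V) (msqrt Y * U * (L * L.transpose) * (msqrt Y * U).transpose)
      (-(1 / Real.sqrt (∑ j, d j ^ 2)) •
        ((msqrt Y * U * L) * Matrix.diagonal d * (msqrt Y * U * L).transpose)) := by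
  have hLdet : IsUnit L.det := by
    rw [det_eq_prod_of_lower hL]
    exact (Finset.prod_pos fun i _ => hL0 i).ne'.isUnit
  have hPdet : IsUnit (msqrt Y * U).det := by
    rw [Matrix.det_mul]
    exact (isUnit_det_msqrt hY).mul
      ((Matrix.isUnit_iff_isUnit_det U).1 (IsUnit.of_mul_eq_one _ hU))
  have hB := fun Z (hZ : Z.PosDef) => busemann_eq_minorSum hY hU hV hd hd0 (Z := Z) hZ
  set c := -(1 / Real.sqrt (∑ j, d j ^ 2)) with hc
  generalize msqrt Y * U = P at *
  set R := P * L with hR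
  have hRdet : IsUnit R.det := by rw [hR, Matrix.det_mul]; exact hPdet.mul hLdet
  have hX : P * (L * L.transpose) * P.transpose = R * R.transpose := by
    simp [hR, mul_assoc]
  have hTR : R⁻¹ * R = 1 := Matrix.nonsing_inv_mul R hRdet
  have hRT : R * R⁻¹ = 1 := Matrix.mul_nonsing_inv R hRdet
  have hTR' : R.transpose * R⁻¹.transpose = 1 := by
    rw [← Matrix.transpose_mul, hTR, Matrix.transpose_one]
  have hRT' : R⁻¹.transpose * R.transpose = 1 := by
    rw [← Matrix.transpose_mul, hRT, Matrix.transpose_one]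
  rw [hX]
  have hcancel : ∀ M, R * (R⁻¹ * M * R⁻¹.transpose) * R.transpose = M := fun M => by
    rw [← mul_assoc, ← mul_assoc, hRT, one_mul, mul_assoc, hRT', mul_one]
  have hcancel' : R⁻¹ * (R * R.transpose) * R⁻¹.transpose = 1 := by
    rw [← mul_assoc, hTR, one_mul, hTR']
  have hXinv : (R * R.transpose)⁻¹ = R⁻¹.transpose * R⁻¹ := by
    rw [Matrix.mul_inv_rev, Matrix.transpose_nonsing_inv]
  obtain ⟨f', hf, hf'⟩ := exists_hasFDerivAt_minorSum d
  obtain ⟨g', hg, hg'⟩ := exists_hasFDerivAt_conj (f := minorSum d) (f' := f') (T := R⁻¹)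
    (X := R * R.transpose) (by rwa [hcancel']) (2 * ∑ j, d j * Real.log (L j j)) c
  -- With `W = R⁻¹ Z R⁻ᵀ` one has `Z = P (L W Lᵀ) Pᵀ`. In the variable `W` the base point is `1`,
  -- and `L` contributes only a constant.
  have hval : ∀ Z ∈ SPD n, busemann Y V Z =
      c * (2 * ∑ j, d j * Real.log (L j j) + minorSum d (R⁻¹ * Z * R⁻¹.transpose)) := by
    intro Z hZ
    have hW : (R⁻¹ * Z * R⁻¹.transpose).PosDef := by
      rw [← Matrix.conjTranspose_eq_transpose_of_trivial]
      exact hZ.mul_mul_conjTranspose_same (Matrix.vecMul_injective_of_isUnit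
        (IsUnit.of_mul_eq_one _ hTR))
    have hLW : (L * (R⁻¹ * Z * R⁻¹.transpose) * L.transpose).PosDef := by
      rw [← Matrix.conjTranspose_eq_transpose_of_trivial L]
      exact hW.mul_mul_conjTranspose_same (Matrix.vecMul_injective_of_isUnit
        ((Matrix.isUnit_iff_isUnit_det L).2 hLdet))
    rw [← minorSum_conj_of_posDef hL hL0 hW, ← hB _ hLW]
    conv_lhs => rw [← hcancel Z]
    simp [hR, mul_assoc]
  refine ⟨?_, g', ?_, fun H _ => ?_⟩
  · simp [Matrix.IsSymm, mul_assoc]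
  · refine hg.hasFDerivWithinAt.congr hval (hval _ ?_)
    have := posDef_transpose_mul_self (M := R.transpose)
      (by rw [Matrix.det_transpose]; exact hRdet.ne_zero)
    simpa [SPD] using this
  · rw [hg', hf', metric, hXinv]
    simp only [Matrix.mul_smul, Matrix.smul_mul, Matrix.trace_smul, smul_eq_mul]
    congr 1
    have e : R⁻¹.transpose * R⁻¹ * (R * Matrix.diagonal d * R.transpose) *
        (R⁻¹.transpose * R⁻¹) * H = R⁻¹.transpose * (Matrix.diagonal d * (R⁻¹ * H)) := by
      calc _ = R⁻¹.transpose * ((R⁻¹ * R) * Matrix.diagonal d * (R.transpose * R⁻¹.transpose) *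
            (R⁻¹ * H)) := by simp only [mul_assoc]
        _ = _ := by rw [hTR, hTR', one_mul, mul_one]
    rw [e, Matrix.trace_mul_comm R⁻¹.transpose]
    simp only [mul_assoc]

end SPDBusemann

theorem mainTheorem10 (n : ℕ) (X Y V : Matrix (Fin n) (Fin n) ℝ)
    (hX : X ∈ SPDBusemann.SPD n) (hY : Y ∈ SPDBusemann.SPD n) (hV : V.IsSymm) (hV0 : V ≠ 0)
    (k : ℕ) (m : Fin k → ℕ) (lam : Fin k → ℝ) (U L : Matrix (Fin n) (Fin n) ℝ)
    (hU : SPDBusemann.IsSpectralDecomp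
      (SPDBusemann.minvsqrt Y * V * SPDBusemann.minvsqrt Y) U m lam)
    (hL : SPDBusemann.IsCholesky
      (U.transpose * SPDBusemann.minvsqrt Y * X * SPDBusemann.minvsqrt Y * U) L) :
    -- the limit that defines the Busemann function exists, with the stated value
    (∃ b : ℝ, Tendsto (SPDBusemann.busemannAux Y V X) atTop (𝓝 b)) ∧
    SPDBusemann.busemann Y V X =
      -2 * (∑ i, (m i : ℝ) * lam i ^ 2) ^ (-(1 / 2) : ℝ) *
        ∑ i, ∑ j ∈ SPDBusemann.block n m i, lam i * Real.log (L j j) ∧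
    SPDBusemann.HasRiemGrad (SPDBusemann.busemann Y V) X
      (-((∑ i, (m i : ℝ) * lam i ^ 2) ^ (-(1 / 2) : ℝ) •
        (SPDBusemann.msqrt Y * U * L * SPDBusemann.blockDiag n m lam *
          L.transpose * U.transpose * SPDBusemann.msqrt Y))) := by
  obtain ⟨hUo, hlam, -, hm, hA⟩ := hU
  obtain ⟨hL, hL0, hLeq⟩ := hL
  rw [SPDBusemann.blockDiag_eq_diagonal] at hA ⊢
  rw [← SPDBusemann.sum_blockEntry_sq hm lam, ← SPDBusemann.sum_blockEntry_mul m lam]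
  have hd := SPDBusemann.monotone_blockEntry hm hlam.monotone
  -- From here on the block structure enters only through the monotone diagonal `d`.
  generalize SPDBusemann.blockEntry n m lam = d at *
  have hUU : U * U.transpose = 1 := (Matrix.mem_orthogonalGroup_iff (Fin n) ℝ).1 hUo
  have hUU' : U.transpose * U = 1 := mul_eq_one_comm.1 hUU
  have hS := SPDBusemann.isUnit_det_msqrt hY
  have hSS : SPDBusemann.msqrt Y * SPDBusemann.minvsqrt Y = 1 := Matrix.mul_nonsing_inv _ hS
  have hSS' : SPDBusemann.minvsqrt Y * SPDBusemann.msqrt Y = 1 := Matrix.nonsing_inv_mul _ hS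
  have hconj : ∀ M, SPDBusemann.msqrt Y * (SPDBusemann.minvsqrt Y * M * SPDBusemann.minvsqrt Y) *
      SPDBusemann.msqrt Y = M := fun M => by
    rw [← mul_assoc, ← mul_assoc, hSS, one_mul, mul_assoc, hSS', mul_one]
  have hd0 : 0 < ∑ j, d j ^ 2 := by
    refine lt_of_le_of_ne (Finset.sum_nonneg fun j _ => sq_nonneg _) fun h => hV0 ?_
    have hdz : d = 0 := funext fun j => pow_eq_zero_iff two_ne_zero |>.1
      ((Finset.sum_eq_zero_iff_of_nonneg fun j _ => sq_nonneg (d j)).1 h.symm j (Finset.mem_univ j))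
    rw [← hconj V, hA, hdz]
    simp
  have hXeq : X = SPDBusemann.msqrt Y * U * (L * L.transpose) *
      (SPDBusemann.msqrt Y * U).transpose := by
    rw [← hLeq, Matrix.transpose_mul, SPDBusemann.transpose_msqrt]
    calc X = SPDBusemann.msqrt Y * (SPDBusemann.minvsqrt Y * X * SPDBusemann.minvsqrt Y) *
          SPDBusemann.msqrt Y := (hconj X).symm
      _ = SPDBusemann.msqrt Y * ((U * U.transpose) * (SPDBusemann.minvsqrt Y * X *
          SPDBusemann.minvsqrt Y) * (U * U.transpose)) * SPDBusemann.msqrt Y := by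
        rw [hUU, one_mul, mul_one]
      _ = _ := by simp only [mul_assoc]
  have hpow : (∑ j, d j ^ 2) ^ (-(1 / 2) : ℝ) = 1 / Real.sqrt (∑ j, d j ^ 2) := by
    rw [Real.rpow_neg hd0.le, ← Real.sqrt_eq_rpow, one_div]
  have hlim := SPDBusemann.tendsto_busemannAux hY hUU hA hd hd0 hL hL0
  have hgrad := SPDBusemann.hasRiemGrad_busemann hY hUU hA hd hd0 hL hL0
  rw [← hXeq] at hlim hgrad
  refine ⟨⟨_, hlim⟩, ?_, ?_⟩
  · rw [SPDBusemann.busemann, hlim.limUnder_eq, hpow]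
    ring
  · rw [hpow, ← neg_smul]
    convert hgrad using 2
    simp [SPDBusemann.transpose_msqrt, mul_assoc]
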